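/- An election consists of a finite set $C$ of candidates, a finite set $N$ of $n$ voters, an approval ballot $A_i\subseteq C$ for each voter $i\in N$, and a nonempty family $\mathcal F\subseteq 2^C$ of feasible sets that is closed under taking subsets. The constraints are \emph{matroid constraints} if for all $X,Y\in\mathcal F$ with $|X|<|Y|$ there is $c\in Y\setminus X$ with $X\cup\{c\}\in\mathcal F$. A group of voters $S\subseteq N$ \emph{deserves} $\ell$ candidates ($\ell\in\mathbb N$) if for each $T\in\mathcal F$ either there is $X\subseteq\bigcap_{i\in S}A_i$ with $|X|\ge \ell$ and $T\cup X\in\mathcal F$, or $\frac{|S|}{n}>\frac{\ell}{|T|+\ell}$. \emph{Phragmén's sequential method} starts with $W=\emptyset$ and all voters having budget $0$; each voter earns money continuously at the rate of $1$ dollar per second. A candidate $c\notin W$ with $W\cup\{c\}\in\mathcal F$ is called available; all other candidates are purchased or removed. As soon as the supporters $N(c)=\{i\in N: c\in A_i\}$ of some available candidate $c$ have $1$ dollar in total, $c$ is purchased: $W$ becomes $W\cup\{c\}$ and the budgets of all voters in $N(c)$ are reset to $0$ (ties between candidates that become affordable at the same time are broken arbitrarily, and one candidate is purchased at a time). The method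 ends when no candidate that has a supporter is available; the set $W$ purchased by then is an outcome. \textbf{Theorem.} Let $W$ be any outcome of Phragmén's sequential method for an election with matroid constraints. For each $\ell\in\mathbb N$ and each nonempty group of voters $S\subseteq N$ that deserves $\ell$ candidates, $$\frac{1}{|S|}\sum_{i\in S}|A_i\cap W|\ \ge\ \frac{\ell-1}{2}.$$ -/

import Mathlib

/-- An approval election with candidate set `C`, voter set `N` and feasibility constraints:
a nonempty, inclusion-closed family of feasible sets of candidates, together with the approval
ballots `A i` of the voters `i`. -/
structure ApprovalElection (C N : Type*) where
  /-- the family of feasible sets -/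
  feasible : Set (Finset C)
  feasible_nonempty : feasible.Nonempty
  feasible_of_subset : ∀ {W W' : Finset C}, W ∈ feasible → W' ⊆ W → W' ∈ feasible
  /-- the approval ballots -/
  A : N → Finset C

namespace ApprovalElection

variable {C N : Type*} [Fintype C] [DecidableEq C] [Fintype N] [DecidableEq N]

/-- The exchange property: the feasibility constraints are matroid constraints. -/
def IsMatroid (E : ApprovalElection C N) : Prop :=
  ∀ X ∈ E.feasible, ∀ Y ∈ E.feasible, X.card < Y.card →
    ∃ c ∈ Y \ X, insert c X ∈ E.feasible

/-- The set `N(c)` of the voters who approve `c`. -/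
def supporters (E : ApprovalElection C N) (c : C) : Finset N :=
  Finset.univ.filter fun i => c ∈ E.A i

/-- The set `⋂ i ∈ S, A i` of the candidates approved by all members of `S`. -/
def commonlyApproved (E : ApprovalElection C N) (S : Finset N) : Finset C :=
  Finset.univ.filter fun c => ∀ i ∈ S, c ∈ E.A i

/-- The group of voters `S` deserves `l` candidates. -/
def Deserves (E : ApprovalElection C N) (S : Finset N) (l : ℕ) : Prop :=
  ∀ T ∈ E.feasible,
    (∃ X ⊆ E.commonlyApproved S, l ≤ X.card ∧ T ∪ X ∈ E.feasible) ∨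
      (S.card : ℝ) / (Fintype.card N : ℝ) > (l : ℝ) / ((T.card : ℝ) + (l : ℝ))

/-- When the set `W` has been purchased, `c` is still in the election: it is neither purchased nor
removed. (Feasibility is inclusion-closed, so a candidate that has been removed stays removed as
`W` grows.) -/
def Available (E : ApprovalElection C N) (W : Finset C) (c : C) : Prop :=
  c ∉ W ∧ insert c W ∈ E.feasible

/-- `E.PhragmenReaches W b`: in some run of Phragmén's sequential method (for some way of breaking
ties between candidates that become affordable at the same moment) there is a moment when `W` is
the set of purchased candidates and `b i` is the budget of voter `i`, in dollars. -/
inductive PhragmenReaches (E : ApprovalElection C N) : Finset C → (N → ℝ) → Prop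
  /-- At the beginning nothing is purchased and all budgets are zero. -/
  | start : PhragmenReaches E ∅ (fun _ => 0)
  /-- For `δ` seconds every voter earns one dollar per second and nothing is purchased. Time cannot
  run past the moment at which the supporters of an available candidate have one dollar. -/
  | wait {W : Finset C} {b : N → ℝ} (δ : ℝ) :
      PhragmenReaches E W b → 0 ≤ δ →
      (∀ c, E.Available W c → ∑ i ∈ E.supporters c, (b i + δ) ≤ 1) →
      PhragmenReaches E W (fun i => b i + δ)
  /-- An available candidate `c` whose supporters have one dollar in total is purchased, and the
  budgets of its supporters are reset to zero. -/
  | purchase {W : Finset C} {b : N → ℝ} (c : C) :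
      PhragmenReaches E W b → E.Available W c →
      ∑ i ∈ E.supporters c, b i = 1 →
      PhragmenReaches E (insert c W) (fun i => if i ∈ E.supporters c then 0 else b i)

/-- `W` is an outcome of Phragmén's sequential method: a run ends with `W` purchased, where every
candidate is purchased or removed, or has no supporters (and so can never be purchased). -/
def IsPhragmenOutcome (E : ApprovalElection C N) (W : Finset C) : Prop :=
  (∃ b : N → ℝ, E.PhragmenReaches W b) ∧ ∀ c, E.Available W c → E.supporters c = ∅

end ApprovalElection

namespace ApprovalElection

set_option linter.unusedSectionVars false

variable {C N : Type*} [Fintype C] [DecidableEq C] [Fintype N] [DecidableEq N]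

/-! Let `s` be the size of `S`, `n` the number of voters and `p` the spending of `S`. While a
commonly approved candidate is available, `S` holds at most one dollar. Meanwhile a potential
argument (`SpendingBound`) shows that satisfaction is at least `s * p / 2` plus `s ^ 3 / 4` times
the variance of the budgets in `S`. Once no such candidate is available, either `S` already has `l`
common candidates, or matroid exchange makes `W` so large that equal earnings force `p ≥ l - 1`.
Satisfaction never decreases afterwards. -/

theorem empty_feasible (E : ApprovalElection C N) : ∅ ∈ E.feasible := by
  obtain ⟨W, hW⟩ := E.feasible_nonempty
  exact E.feasible_of_subset hW (Finset.empty_subset W)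

theorem PhragmenReaches.feasible {E : ApprovalElection C N} {W : Finset C} {b : N → ℝ}
    (h : E.PhragmenReaches W b) : W ∈ E.feasible := by
  induction h with
  | start => exact E.empty_feasible
  | wait => assumption
  | purchase c _ hc => exact hc.2

theorem PhragmenReaches.budget_nonneg {E : ApprovalElection C N} {W : Finset C} {b : N → ℝ}
    (h : E.PhragmenReaches W b) (i : N) : 0 ≤ b i := by
  induction h with
  | start => exact le_rfl
  | wait δ _ hδ _ ih => exact add_nonneg ih hδ
  | purchase c _ _ _ ih =>
    simp only
    split_ifs
    · exact le_rfl
    · exact ih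

theorem subset_supporters {E : ApprovalElection C N} {S : Finset N} {c : C}
    (hc : c ∈ E.commonlyApproved S) : S ⊆ E.supporters c := by
  intro i hi
  simp only [commonlyApproved, supporters, Finset.mem_filter, Finset.mem_univ, true_and] at hc ⊢
  exact hc i hi

/-- The total satisfaction of the group `S` with the set `W`. -/
def satisfaction (E : ApprovalElection C N) (S : Finset N) (W : Finset C) : ℝ :=
  ∑ i ∈ S, ((E.A i ∩ W).card : ℝ)

theorem satisfaction_insert (E : ApprovalElection C N) (S : Finset N) {W : Finset C} {c : C}
    (hc : c ∉ W) :
    E.satisfaction S (insert c W)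
      = E.satisfaction S W + ((S.filter fun i => i ∈ E.supporters c).card : ℝ) := by
  rw [Finset.card_filter, Nat.cast_sum, satisfaction, satisfaction, ← Finset.sum_add_distrib]
  refine Finset.sum_congr rfl fun i _ => ?_
  by_cases h : c ∈ E.A i
  · rw [Finset.inter_insert_of_mem h, Finset.card_insert_of_notMem (by simp [hc])]
    simp [supporters, h]
  · rw [Finset.inter_insert_of_notMem h]
    simp [supporters, h]

theorem card_mul_card_inter_le_satisfaction (E : ApprovalElection C N) (S : Finset N)
    (W : Finset C) :
    (S.card : ℝ) * ((W ∩ E.commonlyApproved S).card : ℝ) ≤ E.satisfaction S W := by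
  rw [satisfaction, ← nsmul_eq_mul]
  refine Finset.card_nsmul_le_sum _ _ _ fun i hi => ?_
  refine Nat.cast_le.2 (Finset.card_le_card fun c hc => ?_)
  simp only [commonlyApproved, Finset.mem_inter, Finset.mem_filter, Finset.mem_univ,
    true_and] at hc ⊢
  exact ⟨hc.2 i hi, hc.1⟩

/-- The group `S` has at most one dollar, and its satisfaction is bounded below by its spending
`p` and the dispersion of its budgets. Spending is determined by the fact that all voters earn the
same amount of money. -/
def SpendingBound (E : ApprovalElection C N) (S : Finset N) (W : Finset C) (b : N → ℝ) : Prop :=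
  ∑ i ∈ S, b i ≤ 1 ∧ ∃ p : ℝ,
    (Fintype.card N : ℝ) * (p + ∑ i ∈ S, b i) = (S.card : ℝ) * (∑ i, b i + (W.card : ℝ)) ∧
    (S.card : ℝ) / 2 * p +
      ((S.card : ℝ) ^ 2 * ∑ i ∈ S, b i ^ 2 - (S.card : ℝ) * (∑ i ∈ S, b i) ^ 2) / 4
        ≤ E.satisfaction S W

theorem spendingBound_start (E : ApprovalElection C N) (S : Finset N) :
    E.SpendingBound S ∅ fun _ => 0 :=
  ⟨by simp, 0, by simp, by simp [satisfaction]⟩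

/-- Variance is invariant under a common shift, and waiting spends nothing. -/
theorem SpendingBound.wait {E : ApprovalElection C N} {S : Finset N} {W : Finset C} {b : N → ℝ}
    (h : E.SpendingBound S W b) (δ : ℝ) (hδ : ∑ i ∈ S, (b i + δ) ≤ 1) :
    E.SpendingBound S W fun i => b i + δ := by
  obtain ⟨-, p, hp, hm⟩ := h
  have h2 : ∑ i ∈ S, (b i + δ) ^ 2
      = ∑ i ∈ S, b i ^ 2 + 2 * δ * ∑ i ∈ S, b i + S.card * δ ^ 2 := by
    simp only [add_sq, Finset.sum_add_distrib, Finset.sum_const, nsmul_eq_mul, Finset.mul_sum]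
    congr 2
    exact Finset.sum_congr rfl fun i _ => by ring
  refine ⟨hδ, p, ?_, ?_⟩
  · simp only [Finset.sum_add_distrib, Finset.sum_const, nsmul_eq_mul, Finset.card_univ]
    linear_combination hp
  · simp only [h2]
    simp only [Finset.sum_add_distrib, Finset.sum_const, nsmul_eq_mul]
    refine le_trans (le_of_eq ?_) hm
    ring

theorem SpendingBound.purchase {E : ApprovalElection C N} {S : Finset N} {W : Finset C}
    {b : N → ℝ} (h : E.SpendingBound S W b) (hb : ∀ i, 0 ≤ b i) {c : C} (hc : c ∉ W)
    (hpay : ∑ i ∈ E.supporters c, b i = 1) :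
    E.SpendingBound S (insert c W) fun i => if i ∈ E.supporters c then 0 else b i := by
  obtain ⟨hR, p, hp, hm⟩ := h
  have key (f : N → ℝ) (U : Finset N) : ∑ i ∈ U, (if i ∈ E.supporters c then 0 else f i)
      = ∑ i ∈ U, f i - ∑ i ∈ U.filter (fun i => i ∈ E.supporters c), f i := by
    rw [eq_sub_iff_add_eq, Finset.sum_filter, ← Finset.sum_add_distrib]
    refine Finset.sum_congr rfl fun i _ => ?_
    split_ifs <;> simp
  have hall : ∑ i, (if i ∈ E.supporters c then 0 else b i) = ∑ i, b i - 1 := by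
    rw [key, Finset.filter_univ_mem, hpay]
  have hsq : ∑ i ∈ S, (if i ∈ E.supporters c then 0 else b i) ^ 2
      = ∑ i ∈ S, b i ^ 2 - ∑ i ∈ S.filter (fun i => i ∈ E.supporters c), b i ^ 2 := by
    rw [← key]
    refine Finset.sum_congr rfl fun i _ => ?_
    split_ifs <;> simp
  -- Summed over payers: `s * x - s ^ 2 * x ^ 2 / 4 ≤ 1`, by completing the square. This fixes the
  -- weight of the dispersion term.
  have hpoint : (S.card : ℝ) * ∑ i ∈ S.filter (fun i => i ∈ E.supporters c), b i
      - (S.card : ℝ) ^ 2 / 4 * ∑ i ∈ S.filter (fun i => i ∈ E.supporters c), b i ^ 2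
      ≤ ((S.filter fun i => i ∈ E.supporters c).card : ℝ) := by
    rw [Finset.mul_sum, Finset.mul_sum, ← Finset.sum_sub_distrib,
      Finset.cast_card (S.filter _)]
    refine Finset.sum_le_sum fun i _ => ?_
    nlinarith [sq_nonneg ((S.card : ℝ) * b i / 2 - 1)]
  have hρ : 0 ≤ ∑ i ∈ S.filter (fun i => i ∈ E.supporters c), b i :=
    Finset.sum_nonneg fun i _ => hb i
  refine ⟨?_, p + ∑ i ∈ S.filter (fun i => i ∈ E.supporters c), b i, ?_, ?_⟩
  · rw [key]
    linarith
  · simp only [key b S, hall, Finset.card_insert_of_notMem hc, Nat.cast_add, Nat.cast_one]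
    linear_combination hp
  · simp only [hsq, key b S, E.satisfaction_insert S hc]
    have hs : (0 : ℝ) ≤ S.card := Nat.cast_nonneg _
    -- If the payers in `S` spend `ρ` out of `R ≤ 1`, the potential rises by `s * ρ / 2 + s * (2 * R
    -- * ρ - ρ ^ 2) / 4` minus the squares term, so `hpoint` suffices.
    have h1 := mul_nonneg hs (mul_nonneg hρ (sub_nonneg.2 hR))
    have h2 := mul_nonneg hs
      (sq_nonneg (∑ i ∈ S.filter (fun i => i ∈ E.supporters c), b i))
    nlinarith

/-- If no commonly approved candidate is available, then a set that extends part of `W` by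
commonly approved candidates is no larger than `W`. -/
theorem card_union_le_of_not_available {E : ApprovalElection C N} (hE : E.IsMatroid)
    {S : Finset N} {W T X : Finset C} (hW : W ∈ E.feasible)
    (hQ : ∀ c ∈ E.commonlyApproved S, ¬ E.Available W c) (hT : T ⊆ W)
    (hX : X ⊆ E.commonlyApproved S) (hTX : T ∪ X ∈ E.feasible) : (T ∪ X).card ≤ W.card := by
  by_contra! hlt
  obtain ⟨c, hc, hins⟩ := hE W hW _ hTX hlt
  rw [Finset.mem_sdiff, Finset.mem_union] at hc
  rcases hc.1 with h | h
  · exact hc.2 (hT h)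
  · exact hQ c (hX h) ⟨hc.2, hins⟩

/-- If no commonly approved candidate is available, then a group that deserves `l` candidates has
received `l` of them, or many candidates have been purchased. -/
theorem Deserves.lt_card_mul_card_add_one {E : ApprovalElection C N} (hE : E.IsMatroid)
    {S : Finset N} {l : ℕ} (hl : E.Deserves S l) (hS : S.Nonempty) {W : Finset C}
    (hW : W ∈ E.feasible)
    (hQ : ∀ c ∈ E.commonlyApproved S, ¬ E.Available W c)
    (hlt : (W ∩ E.commonlyApproved S).card < l) :
    (l : ℝ) * (Fintype.card N : ℝ) < (S.card : ℝ) * ((W.card : ℝ) + 1) := by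
  have hl0 : (0 : ℝ) < l := Nat.cast_pos.2 (by omega)
  have hs : (0 : ℝ) < S.card := Nat.cast_pos.2 hS.card_pos
  have hsn : (S.card : ℝ) ≤ Fintype.card N := Nat.cast_le.2 (Finset.card_le_univ S)
  have hn : (0 : ℝ) < Fintype.card N := hs.trans_le hsn
  -- Removing `l - 1` members of `W`, including all common ones, makes `W \ R` disjoint from `X`;
  -- adding `l` would then exceed the size of `W`.
  obtain ⟨R, hQR, hRW, hR⟩ := Finset.exists_subsuperset_card_eq
    (n := min (l - 1) W.card) (Finset.inter_subset_left (s₁ := W) (s₂ := E.commonlyApproved S))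
    (le_min (by omega) (Finset.card_le_card Finset.inter_subset_left)) (min_le_right _ _)
  have hT : (W \ R).card = W.card - min (l - 1) W.card := by
    rw [Finset.card_sdiff_of_subset hRW, hR]
  rcases hl (W \ R) (E.feasible_of_subset hW Finset.sdiff_subset) with ⟨X, hX, hlX, hF⟩ | h
  · exfalso
    have hdis : Disjoint (W \ R) X := by
      rw [Finset.disjoint_left]
      intro c hc hcX
      rw [Finset.mem_sdiff] at hc
      exact hc.2 (hQR (Finset.mem_inter.2 ⟨hc.1, hX hcX⟩))
    have := card_union_le_of_not_available hE hW hQ Finset.sdiff_subset hX hF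
    rw [Finset.card_union_of_disjoint hdis, hT] at this
    omega
  · rw [gt_iff_lt, div_lt_div_iff₀ (by positivity) hn] at h
    rcases le_total (l - 1) W.card with h' | h'
    · have h1 : (((W \ R).card : ℝ) + l) = W.card + 1 := by
        rw [min_eq_left h'] at hT
        have : (W \ R).card + l = W.card + 1 := by omega
        exact_mod_cast this
      rwa [h1] at h
    -- With `T` empty, deserving would need `s > n`.
    · have h1 : ((W \ R).card : ℝ) = 0 := by
        rw [min_eq_right h'] at hT
        simp [hT]
      rw [h1] at h
      nlinarith

theorem SpendingBound.le_satisfaction {E : ApprovalElection C N} (hE : E.IsMatroid)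
    {S : Finset N} {l : ℕ} (hl : E.Deserves S l) (hS : S.Nonempty) {W : Finset C} {b : N → ℝ}
    (h : E.SpendingBound S W b) (hb : ∀ i, 0 ≤ b i) (hW : W ∈ E.feasible)
    (hQ : ∀ c ∈ E.commonlyApproved S, ¬ E.Available W c) :
    (S.card : ℝ) * (((l : ℝ) - 1) / 2) ≤ E.satisfaction S W := by
  have hs : (0 : ℝ) < S.card := Nat.cast_pos.2 hS.card_pos
  have hsn : (S.card : ℝ) ≤ Fintype.card N := Nat.cast_le.2 (Finset.card_le_univ S)
  have hn : (0 : ℝ) < Fintype.card N := hs.trans_le hsn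
  rcases le_or_gt l (W ∩ E.commonlyApproved S).card with hle | hlt
  · refine le_trans (mul_le_mul_of_nonneg_left ?_ hs.le)
      (E.card_mul_card_inter_le_satisfaction S W)
    have h1 : (l : ℝ) ≤ (W ∩ E.commonlyApproved S).card := Nat.cast_le.2 hle
    have h2 : (0 : ℝ) ≤ l := Nat.cast_nonneg l
    linarith
  · have hcard := hl.lt_card_mul_card_add_one hE hS hW hQ hlt
    obtain ⟨hR, p, hp, hm⟩ := h
    have hRB : ∑ i ∈ S, b i ≤ ∑ i, b i :=
      Finset.sum_le_univ_sum_of_nonneg hb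
    have hCS : (∑ i ∈ S, b i) ^ 2 ≤ S.card * ∑ i ∈ S, b i ^ 2 := sq_sum_le_card_mul_sum_sq
    -- With `B` the total budget, `n * p = s * (B + |W|) - n * R > l * n - s - (n - s) * R ≥ (l - 1)
    -- * n`, using `R ≤ B` and `R ≤ 1`.
    have hpl : (l : ℝ) - 1 ≤ p := by
      refine le_of_mul_le_mul_left ?_ hn
      nlinarith [mul_nonneg hs.le (sub_nonneg.2 hRB),
        mul_nonneg (sub_nonneg.2 hsn) (sub_nonneg.2 hR)]
    nlinarith [mul_nonneg hs.le (sub_nonneg.2 hCS), mul_nonneg hs.le (sub_nonneg.2 hpl)]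

theorem PhragmenReaches.spendingBound_or_le_satisfaction {E : ApprovalElection C N}
    (hE : E.IsMatroid) {S : Finset N} {l : ℕ} (hl : E.Deserves S l) (hS : S.Nonempty)
    {W : Finset C} {b : N → ℝ} (h : E.PhragmenReaches W b) :
    E.SpendingBound S W b ∨ (S.card : ℝ) * (((l : ℝ) - 1) / 2) ≤ E.satisfaction S W := by
  induction h with
  | start => exact Or.inl (E.spendingBound_start S)
  | @wait W b δ hr hδ hle ih =>
    rcases ih with ih | ih
    · by_cases hQ : ∀ c ∈ E.commonlyApproved S, ¬ E.Available W c
      · exact Or.inr (ih.le_satisfaction hE hl hS hr.budget_nonneg hr.feasible hQ)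
      · push Not at hQ
        obtain ⟨c, hc, hav⟩ := hQ
        refine Or.inl (ih.wait δ (le_trans ?_ (hle c hav)))
        exact Finset.sum_le_sum_of_subset_of_nonneg (subset_supporters hc)
          fun i _ _ => add_nonneg (hr.budget_nonneg i) hδ
    · exact Or.inr ih
  | purchase c hr hav hpay ih =>
    rcases ih with ih | ih
    · exact Or.inl (ih.purchase hr.budget_nonneg hav.1 hpay)
    · refine Or.inr (ih.trans ?_)
      rw [E.satisfaction_insert S hav.1]
      exact le_add_of_nonneg_right (Nat.cast_nonneg _)

end ApprovalElection

theorem mainTheorem5 {C N : Type*} [Fintype C] [DecidableEq C] [Fintype N] [DecidableEq N]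
    (E : ApprovalElection C N) (hE : E.IsMatroid)
    (W : Finset C) (hW : E.IsPhragmenOutcome W)
    (S : Finset N) (hS : S.Nonempty) (l : ℕ) (hl : E.Deserves S l) :
    (1 / (S.card : ℝ)) * ∑ i ∈ S, ((E.A i ∩ W).card : ℝ) ≥ ((l : ℝ) - 1) / 2 := by
  obtain ⟨⟨b, hr⟩, hend⟩ := hW
  have hs : (0 : ℝ) < S.card := Nat.cast_pos.2 hS.card_pos
  have hQ : ∀ c ∈ E.commonlyApproved S, ¬ E.Available W c := by
    intro c hc hav
    have hsub := ApprovalElection.subset_supporters hc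
    rw [hend c hav, Finset.subset_empty] at hsub
    exact hS.ne_empty hsub
  have hmain : (S.card : ℝ) * (((l : ℝ) - 1) / 2) ≤ E.satisfaction S W := by
    rcases hr.spendingBound_or_le_satisfaction hE hl hS with h | h
    · exact h.le_satisfaction hE hl hS hr.budget_nonneg hr.feasible hQ
    · exact h
  rw [ge_iff_le, one_div, ← div_eq_inv_mul, le_div_iff₀ hs, mul_comm]
  exact hmain
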